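/- A band is a semigroup in which every element is idempotent; it is normal if it satisfies the identity $xyzx=xzyx$. A rectangular band is a band satisfying $xyx=x$. A band $B$ is a semilattice $Y$ of rectangular bands $B_\alpha$ ($\alpha\in Y$) if $B$ is the disjoint union of non-empty rectangular bands $B_\alpha$ with $B_\alpha B_\beta\subseteq B_{\alpha\beta}$ for all $\alpha,\beta$ in the semilattice $Y$. It is a strong semilattice $B=\mathcal{B}(Y;B_\alpha,\phi_{\alpha,\beta})$ of rectangular bands if in addition there are morphisms $\phi_{\alpha,\beta}:B_\alpha\to B_\beta$ for $\alpha\ge\beta$ (written on the right) with $\phi_{\alpha,\alpha}=1_{B_\alpha}$, $\phi_{\alpha,\beta}\phi_{\beta,\gamma}=\phi_{\alpha,\gamma}$ for $\alpha\ge\beta\ge\gamma$, and $xy=(x\phi_{\alpha,\alpha\beta})(y\phi_{\beta,\alpha\beta})$ for all $x\in B_\alpha$, $y\in B_\beta$. Every normal band is such a strong semilattice. The band $B$ is called $Y$-basic if it is a semilattice $Y$ of rectangular bands $B_\alpha$ each of which is a left zero band ($xy=x$) or a right zero band ($xy=y$). A normal band $B=\mathcal{B}(Y;B_\alpha,\phi_{\alpha,\beta})$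 is called pliant if for every $\alpha\in Y$ there is $a_\alpha\in B_\alpha$ such that $u\phi_{\beta,\alpha}=a_\alpha$ for all $\beta>\alpha$ and all $u\in B_\beta$. The free idempotent generated semigroup over $B$ is the semigroup given by the presentation $$\mathrm{IG}(B)=\langle\,\overline{e}\ (e\in B)\ :\ \overline{e}\,\overline{f}=\overline{ef}\ \text{ whenever } \{e,f\}\cap\{ef,fe\}\neq\emptyset\,\rangle .$$ On a semigroup $S$ let $a\,\mathcal{L}^*\,b$ mean that $ax=ay\Leftrightarrow bx=by$ for all $x,y\in S^1$, and let $a\,\mathcal{R}^*\,b$ mean that $xa=ya\Leftrightarrow xb=yb$ for all $x,y\in S^1$. A semigroup is abundant if each $\mathcal{L}^*$-class and each $\mathcal{R}^*$-class contains an idempotent. **Theorem.** Let $B$ be a normal band that is $Y$-basic or pliant. Then $\mathrm{IG}(B)$ is abundant. -/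

import Mathlib

universe u

namespace IGBand

/-- A band: a semigroup all of whose elements are idempotent. -/
def IsBand (S : Type*) [Semigroup S] : Prop := ∀ x : S, IsIdempotentElem x

/-- A rectangular band: a band satisfying `xyx = x`. -/
def IsRectangularBand (S : Type*) [Semigroup S] : Prop :=
  IsBand S ∧ ∀ x y : S, x * y * x = x

/-- A left zero semigroup: `xy = x`. -/
def IsLeftZero (S : Type*) [Semigroup S] : Prop := ∀ x y : S, x * y = x

/-- A right zero semigroup: `xy = y`. -/
def IsRightZero (S : Type*) [Semigroup S] : Prop := ∀ x y : S, x * y = y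

/-- A normal band: a band satisfying `xyzx = xzyx`. -/
def IsNormalBand (S : Type*) [Semigroup S] : Prop :=
  IsBand S ∧ ∀ x y z : S, x * y * z * x = x * z * y * x

/-- A grading of the semigroup `B` by the (meet) semilattice `Y`: every element `x` lies in the
component `B_α` with index `α = index x`, no component is empty, and `B_α B_β ⊆ B_{αβ}`. -/
structure SemilatticeGrading (B : Type*) [Semigroup B] (Y : Type*) [SemilatticeInf Y] where
  index : B → Y
  index_surjective : Function.Surjective index
  index_mul : ∀ x y : B, index (x * y) = index x ⊓ index y

/-- The component `B_α`. -/
def SemilatticeGrading.component {B : Type*} [Semigroup B] {Y : Type*} [SemilatticeInf Y]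
    (G : SemilatticeGrading B Y) (α : Y) : Subsemigroup B where
  carrier := {x | G.index x = α}
  mul_mem' := by
    intro x y hx hy
    simp only [Set.mem_ofPred_eq] at hx hy ⊢
    rw [G.index_mul, hx, hy, inf_idem]

/-- `B` is a semilattice `Y` of rectangular bands `B_α`. -/
structure SemilatticeOfRectangularBands (B : Type*) [Semigroup B] (Y : Type*) [SemilatticeInf Y]
    extends SemilatticeGrading B Y where
  rectangular : ∀ α : Y, IsRectangularBand (toSemilatticeGrading.component α)

/-- `B = 𝓑(Y; B_α, φ_{α,β})` is a strong semilattice `Y` of rectangular bands `B_α`, with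
structure morphisms `φ_{α,β} : B_α → B_β` for `α ≥ β`. -/
structure StrongSemilatticeOfRectangularBands (B : Type*) [Semigroup B]
    (Y : Type*) [SemilatticeInf Y] extends SemilatticeOfRectangularBands B Y where
  φ : ∀ {α β : Y}, β ≤ α →
    (toSemilatticeGrading.component α →ₙ* toSemilatticeGrading.component β)
  φ_refl : ∀ (α : Y) (x : toSemilatticeGrading.component α), φ (le_refl α) x = x
  φ_trans : ∀ {α β γ : Y} (hβ : β ≤ α) (hγ : γ ≤ β) (x : toSemilatticeGrading.component α),
    φ hγ (φ hβ x) = φ (hγ.trans hβ) x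
  mul_eq : ∀ {α β : Y} (x : toSemilatticeGrading.component α)
    (y : toSemilatticeGrading.component β),
    (x : B) * (y : B) =
      ((φ (inf_le_left : α ⊓ β ≤ α) x * φ (inf_le_right : α ⊓ β ≤ β) y :
        toSemilatticeGrading.component (α ⊓ β)) : B)

/-- `B` is `Y`-basic for some semilattice `Y`: it is a semilattice `Y` of rectangular bands `B_α`,
each of which is a left zero band or a right zero band. (As `B` maps onto `Y`, nothing is lost by
taking `Y` in the universe of `B`.) -/
def IsYBasic (B : Type u) [Semigroup B] : Prop :=
  ∃ (Y : Type u) (_ : SemilatticeInf Y) (G : SemilatticeOfRectangularBands B Y),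
    ∀ α : Y, IsLeftZero (G.component α) ∨ IsRightZero (G.component α)

/-- `B` is pliant: it is a strong semilattice of rectangular bands such that every `B_α` contains
an element `a_α` with `u φ_{β,α} = a_α` for all `β > α` and all `u ∈ B_β`. -/
def IsPliant (B : Type u) [Semigroup B] : Prop :=
  ∃ (Y : Type u) (_ : SemilatticeInf Y) (G : StrongSemilatticeOfRectangularBands B Y),
    ∀ α : Y, ∃ a : G.component α, ∀ (β : Y) (h : α < β) (u : G.component β), G.φ h.le u = a

/-- The set `E(S)` of idempotents of `S`. -/
abbrev Idem (S : Type*) [Semigroup S] : Type _ := {e : S // IsIdempotentElem e}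

/-- `(e, f)` is a basic pair: `{e, f} ∩ {ef, fe} ≠ ∅`. -/
def IsBasicPair {S : Type*} [Semigroup S] (e f : S) : Prop :=
  (({e, f} : Set S) ∩ {e * f, f * e}).Nonempty

/-- The product of a basic pair of idempotents is idempotent. -/
theorem IsBasicPair.isIdempotentElem_mul {S : Type*} [Semigroup S] {e f : S}
    (h : IsBasicPair e f) (he : IsIdempotentElem e) (hf : IsIdempotentElem f) :
    IsIdempotentElem (e * f) := by
  obtain ⟨x, hx, hy⟩ := h
  simp only [Set.mem_insert_iff, Set.mem_singleton_iff] at hx hy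
  unfold IsIdempotentElem at *
  have key : e * f * (e * f) = e * (f * e) * f := by simp only [mul_assoc]
  rcases hx with rfl | rfl <;> rcases hy with hy | hy
  · rw [← hy, he]
  · rw [key, ← hy, he]
  · rw [← hy, hf]
  · rw [key, ← hy, mul_assoc, hf]

/-- The defining relations `ē f̄ = \overline{ef}`, for `(e, f)` a basic pair in `E(S)`. -/
inductive IGRel (S : Type*) [Semigroup S] :
    FreeSemigroup (Idem S) → FreeSemigroup (Idem S) → Prop
  | basic (e f : Idem S) (h : IsBasicPair (e : S) (f : S)) :
      IGRel S (FreeSemigroup.of e * FreeSemigroup.of f)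
        (FreeSemigroup.of ⟨(e : S) * (f : S), h.isIdempotentElem_mul e.2 f.2⟩)

/-- The free idempotent generated semigroup `IG(E)` over the biordered set `E = E(S)`: the
quotient of the free semigroup on `E(S)` by the congruence generated by the relations `IGRel`.
For a band `B` one has `E(B) = B`, and `IG B` is the semigroup `IG(B)`. -/
abbrev IG (S : Type*) [Semigroup S] : Type _ := (conGen (IGRel S)).Quotient

/-- The relation `𝓛*`. (`WithOne S` always adjoins a new identity; if `S` already has one, this
gives the same relation.) -/
def LStar {S : Type*} [Semigroup S] (a b : S) : Prop :=
  ∀ x y : WithOne S, (a : WithOne S) * x = (a : WithOne S) * y ↔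
    (b : WithOne S) * x = (b : WithOne S) * y

/-- The relation `𝓡*`. -/
def RStar {S : Type*} [Semigroup S] (a b : S) : Prop :=
  ∀ x y : WithOne S, x * (a : WithOne S) = y * (a : WithOne S) ↔
    x * (b : WithOne S) = y * (b : WithOne S)

/-- `S` is abundant: every `𝓛*`-class and every `𝓡*`-class contains an idempotent. -/
def IsAbundant (S : Type*) [Semigroup S] : Prop :=
  (∀ a : S, ∃ e : S, IsIdempotentElem e ∧ LStar a e) ∧
    ∀ a : S, ∃ e : S, IsIdempotentElem e ∧ RStar a e

end IGBand

namespace IGBand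

open MulOpposite

/-! Every element of `IG B` is a product of generators in which consecutive indices are equal or
incomparable (`IsReducedProduct.exists_of_presentation`). Such a product is 𝓡*-related to its first
generator, because its other letters can be cancelled from the right one at a time
(`IsReducedProduct.rStar`). The conditions on `B` are self-dual, so 𝓛* follows by passing to
opposites.

Cancelling a letter next to one of equal index is a computation in a rectangular band
(`mul_mul_cancel`). The incomparable case, `mul_right_cancel_of_incomparable`, is the heart: from `X
* g c * g b` one must recover `X * g c`. To this end the generators act on stacks of indices. When a
letter `b` is pushed onto a top of index `α`, the new entry stores the current value times `g (a
α)`. This factor makes the record compatible with the defining relations, since letters of index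
above `α` are absorbed between a letter of index `α` and `g (a α)`. Such a choice of `a` is given by
`exists_section`, the one place where the Y-basic or pliant condition enters. The factor loses
nothing, as `mul_mul_cancel` removes it again. -/

/-- A normal band graded by a semilattice into rectangular bands, such that each component is
left zero, right zero, or the target of a constant map from every larger component. -/
structure IsAdmissibleGrading {B Y : Type u} [Semigroup B] [SemilatticeInf Y] (idx : B → Y) :
    Prop where
  idx_mul : ∀ x y, idx (x * y) = idx x ⊓ idx y
  idem : ∀ x : B, x * x = x
  rect : ∀ x y : B, idx x = idx y → x * y * x = x
  normal : ∀ x y z : B, x * y * z * x = x * z * y * x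
  exists_base : ∀ α : Y, ∃ a : B, idx a = α ∧
    ((∀ x y, idx x = α → idx y = α → x * y = x) ∨
      (∀ x y, idx x = α → idx y = α → x * y = y) ∨
      ∀ x d, α < idx x → idx d = α → x * d * x = a)

/-- `g : B → S` presents `S` by generators `B` and the relations given by the basic pairs. -/
structure IsBasicPresentation {B S : Type u} [Semigroup B] [Semigroup S] (g : B → S) : Prop where
  map_mul : ∀ e f : B, IsBasicPair e f → g e * g f = g (e * f)
  induction : ∀ P : S → Prop, (∀ b, P (g b)) → (∀ s t, P s → P t → P (s * t)) → ∀ s, P s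
  exists_lift : ∀ (T : Type u) [Semigroup T] (f : B → T),
    (∀ x y, IsBasicPair x y → f x * f y = f (x * y)) → ∃ F : S →ₙ* T, ∀ b, F (g b) = f b

/-! ### Basic pairs and their symmetry. -/

theorem IsBasicPair.of_mul_eq_left {B : Type*} [Semigroup B] {e f : B} (h : e * f = e) :
    IsBasicPair e f := ⟨e, by simp [h]⟩

theorem IsBasicPair.of_mul_eq_right {B : Type*} [Semigroup B] {e f : B} (h : e * f = f) :
    IsBasicPair e f := ⟨f, by simp [h]⟩

theorem IsBasicPair.of_mul_eq_left' {B : Type*} [Semigroup B] {e f : B} (h : f * e = e) :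
    IsBasicPair e f := ⟨e, by simp [h]⟩

theorem IsBasicPair.of_mul_eq_right' {B : Type*} [Semigroup B] {e f : B} (h : f * e = f) :
    IsBasicPair e f := ⟨f, by simp [h]⟩

theorem IsBasicPair.symm {B : Type*} [Semigroup B] {e f : B} (h : IsBasicPair e f) :
    IsBasicPair f e := by
  unfold IsBasicPair at *
  rwa [Set.pair_comm f e, Set.pair_comm (f * e) (e * f)]

theorem IsBasicPair.unop {B : Type*} [Semigroup B] {e f : Bᵐᵒᵖ} (h : IsBasicPair e f) :
    IsBasicPair (unop e) (unop f) := by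
  obtain ⟨x, hx, hy⟩ := h
  simp only [Set.mem_insert_iff, Set.mem_singleton_iff] at hx hy
  refine ⟨MulOpposite.unop x, ?_, ?_⟩
  · rcases hx with rfl | rfl <;> simp
  · rcases hy with rfl | rfl <;> simp

theorem IsBasicPair.op {B : Type*} [Semigroup B] {e f : B} (h : IsBasicPair e f) :
    IsBasicPair (op e) (op f) := by
  obtain ⟨x, hx, hy⟩ := h
  simp only [Set.mem_insert_iff, Set.mem_singleton_iff] at hx hy
  refine ⟨MulOpposite.op x, ?_, ?_⟩
  · rcases hx with rfl | rfl <;> simp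
  · rcases hy with rfl | rfl <;> simp

/-! ### Conjugation `d ↦ x * d * x` as the structure map to a lower component. -/

namespace IsAdmissibleGrading

variable {B Y : Type u} [Semigroup B] [SemilatticeInf Y] {idx : B → Y}

theorem op (G : IsAdmissibleGrading idx) :
    IsAdmissibleGrading (fun b : Bᵐᵒᵖ => idx (unop b)) where
  idx_mul x y := by simp [G.idx_mul, inf_comm]
  idem x := unop_injective (G.idem _)
  rect x y h := unop_injective (by simpa [mul_assoc] using G.rect _ _ h)
  normal x y z := unop_injective (by
    simpa [mul_assoc] using (G.normal (unop x) (unop z) (unop y)))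
  exists_base α := by
    obtain ⟨a, ha, h⟩ := G.exists_base α
    refine ⟨MulOpposite.op a, ha, ?_⟩
    rcases h with h | h | h
    · exact Or.inr (Or.inl fun x y hx hy => unop_injective (h _ _ hy hx))
    · exact Or.inl fun x y hx hy => unop_injective (h _ _ hy hx)
    · exact Or.inr (Or.inr fun x d hx hd => unop_injective (by
        simpa [mul_assoc] using h _ _ hx hd))

theorem idx_conj (G : IsAdmissibleGrading idx) {x d : B} (h : idx d ≤ idx x) :
    idx (x * d * x) = idx d := by
  rw [G.idx_mul, G.idx_mul, inf_eq_right.2 h, inf_eq_left.2 h]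

theorem rect_of_le (G : IsAdmissibleGrading idx) {x d : B} (h : idx d ≤ idx x) :
    d * x * d = d := by
  have := G.rect d (x * d * x) (G.idx_conj h).symm
  calc d * x * d = d * x * (d * x * d) := by
        rw [← mul_assoc, ← mul_assoc, mul_assoc (d * x), mul_assoc, ← mul_assoc, G.idem]
    _ = d := by simpa only [mul_assoc] using this

/-- The structure map at `x` does not depend on the representative of the lower component. -/
theorem conj_eq (G : IsAdmissibleGrading idx) (x : B) {d e : B} (h : idx d = idx e) :
    x * d * x = x * e * x := by
  calc x * d * x = x * (d * e) * d * x := by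
        rw [mul_assoc x (d * e) d, G.rect d e h]
    _ = x * d * (d * e) * x := G.normal _ _ _
    _ = x * d * e * x := by rw [← mul_assoc (x * d), mul_assoc x d d, G.idem]
    _ = x * e * d * x := G.normal _ _ _
    _ = x * e * (e * d) * x := by rw [← mul_assoc (x * e), mul_assoc x e e, G.idem]
    _ = x * (e * d) * e * x := G.normal _ _ _
    _ = x * e * x := by rw [mul_assoc x (e * d) e, G.rect e d h.symm]

end IsAdmissibleGrading

/-! ### Consequences of the defining relations. -/

namespace IsBasicPresentation

variable {B Y S : Type u} [Semigroup B] [SemilatticeInf Y] [Semigroup S] {idx : B → Y} {g : B → S}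

theorem op (hg : IsBasicPresentation g) :
    IsBasicPresentation (fun b : Bᵐᵒᵖ => MulOpposite.op (g (unop b))) where
  map_mul e f h := unop_injective (by simpa using hg.map_mul _ _ h.unop.symm)
  induction P h1 h2 s := hg.induction (fun s => P (MulOpposite.op s))
    (fun b => h1 (MulOpposite.op b)) (fun s t hs ht => h2 _ _ ht hs) s.unop
  exists_lift T _ f hf := by
    obtain ⟨F, hF⟩ := hg.exists_lift Tᵐᵒᵖ (fun b => MulOpposite.op (f (MulOpposite.op b)))
      (fun x y h => unop_injective (by simpa using hf _ _ h.symm.op))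
    exact ⟨⟨fun s => unop (F (unop s)), fun x y => by simp⟩, fun b => by simp [hF]⟩

theorem map_idem (hg : IsBasicPresentation g) (G : IsAdmissibleGrading idx) (b : B) :
    g b * g b = g b := by
  rw [hg.map_mul _ _ (.of_mul_eq_left (G.idem b)), G.idem]

/-- A generator acts on the right of a lower generator through the structure map. -/
theorem mul_eq_mul_conj (hg : IsBasicPresentation g) (G : IsAdmissibleGrading idx) {d x : B}
    (h : idx d ≤ idx x) : g d * g x = g d * g (x * d * x) := by
  have hd : d * (x * d) = d := by rw [← mul_assoc, G.rect_of_le h]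
  have h2 : x * (x * d) = x * d := by rw [← mul_assoc, G.idem]
  calc g d * g x = g d * g (x * d) * g x := by rw [hg.map_mul _ _ (.of_mul_eq_left hd), hd]
    _ = g d * g (x * d * x) := by rw [mul_assoc, hg.map_mul _ _ (.of_mul_eq_left' h2)]

/-- A generator acts on the left of a lower generator through the structure map. -/
theorem mul_eq_conj_mul (hg : IsBasicPresentation g) (G : IsAdmissibleGrading idx) {d x : B}
    (h : idx d ≤ idx x) : g x * g d = g (x * d * x) * g d := by
  have hd : d * x * d = d := G.rect_of_le h
  have h2 : d * x * x = d * x := by rw [mul_assoc, G.idem]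
  calc g x * g d = g x * (g (d * x) * g d) := by rw [hg.map_mul _ _ (.of_mul_eq_right hd), hd]
    _ = g (x * d * x) * g d := by
      rw [← mul_assoc, hg.map_mul _ _ (.of_mul_eq_right' h2), mul_assoc x]

/-- Since `h * k * h = h`, both products formed from the right are basic. Thus right multiplication
by a generator is reversible on products ending in its own component. -/
theorem mul_mul_cancel (hg : IsBasicPresentation g) (G : IsAdmissibleGrading idx) {h k : B}
    (e : idx h = idx k) : g h * g k * g (k * h) = g h := by
  have h1 : k * (k * h) = k * h := by rw [← mul_assoc, G.idem]
  have h2 : h * (k * h) = h := by rw [← mul_assoc, G.rect h k e]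
  rw [mul_assoc, hg.map_mul _ _ (.of_mul_eq_right h1), h1, hg.map_mul _ _ (.of_mul_eq_left h2), h2]

end IsBasicPresentation

/-- The letter `x` acts on `g d` as its image `x * d * x` in the component of `d`. A left zero
component absorbs this image into `d`, a right zero one into the base point, and in the remaining
case the image is the base point. -/
theorem IsAdmissibleGrading.exists_section {B Y S : Type u} [Semigroup B] [SemilatticeInf Y]
    [Semigroup S] {idx : B → Y} {g : B → S} (G : IsAdmissibleGrading idx)
    (hg : IsBasicPresentation g) :
    ∃ a : Y → B, (∀ α, idx (a α) = α) ∧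
      ∀ d x, idx d < idx x → g d * g x * g (a (idx d)) = g d * g (a (idx d)) := by
  choose a ha h using G.exists_base
  refine ⟨a, ha, fun d x hx => ?_⟩
  have hi := G.idx_conj hx.le
  rw [hg.mul_eq_mul_conj G hx.le]
  rcases h (idx d) with h | h | h
  · have := h d (x * d * x) rfl hi
    rw [hg.map_mul _ _ (.of_mul_eq_left this), this]
  · have := h (x * d * x) (a (idx d)) hi (ha _)
    rw [mul_assoc, hg.map_mul _ _ (.of_mul_eq_right this), this]
  · rw [h x d hx rfl, mul_assoc, hg.map_idem G]

/-! ### Combinatorics of stacks of indices. -/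

section Stack

variable {Y M : Type*} [SemilatticeInf Y]

open Classical in
/-- Pop all entries of index greater than `β`, then push `β`; every entry remembers a datum
attached to what lies below it. -/
noncomputable def pushStack (β : Y) : M → List (Y × M) → List (Y × M)
  | q, [] => [(β, q)]
  | q, p :: t => if β < p.1 then pushStack β p.2 t else (β, q) :: p :: t

theorem exists_pushStack_eq_cons (β : Y) (q : M) (l : List (Y × M)) :
    ∃ r t, pushStack β q l = (β, r) :: t := by
  induction l generalizing q with
  | nil => exact ⟨q, [], rfl⟩
  | cons p t ih =>
    rw [pushStack]
    split_ifs
    · exact ih _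
    · exact ⟨_, _, rfl⟩

/-- Whatever `γ` pops, the smaller `β` would pop too. Popping the entry of `γ` hands back the datum
stored there, so the fresh datum `r` plays no role. -/
theorem pushStack_pushStack {β γ : Y} (h : β < γ) (q r : M) (l : List (Y × M)) :
    pushStack β r (pushStack γ q l) = pushStack β q l := by
  induction l generalizing q with
  | nil => simp [pushStack, h]
  | cons p t ih =>
    by_cases hp : γ < p.1
    · simp [pushStack, hp, h.trans hp, ih]
    · conv_lhs => rw [pushStack, if_neg hp, pushStack, if_pos h]

open Classical in
/-- The stack after reading a letter of index `β`, where `q α` is the datum to be remembered when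
the top has index `α`. -/
noncomputable def stepStack [One M] (q : Y → M) (β : Y) : List (Y × M) → List (Y × M)
  | [] => [(β, 1)]
  | p :: t => if p.1 ≤ β then p :: t else pushStack β (q p.1) (p :: t)

theorem exists_stepStack_eq_cons [One M] (q : Y → M) (β : Y) (l : List (Y × M)) :
    ∃ p t, stepStack q β l = p :: t ∧ p.1 ≤ β := by
  cases l with
  | nil => exact ⟨_, _, rfl, le_rfl⟩
  | cons p t =>
    rw [stepStack]
    split_ifs with h
    · exact ⟨_, _, rfl, h⟩
    · obtain ⟨r, t', e⟩ := exists_pushStack_eq_cons β (q p.1) (p :: t)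
      exact ⟨_, _, e, le_rfl⟩

theorem stepStack_stepStack_of_le [One M] (q r : Y → M) {β γ : Y} (h : β ≤ γ)
    (l : List (Y × M)) : stepStack r γ (stepStack q β l) = stepStack q β l := by
  obtain ⟨p, t, e, hp⟩ := exists_stepStack_eq_cons q β l
  rw [e, stepStack, if_pos (hp.trans h)]

theorem stepStack_stepStack_of_lt [One M] (q r : Y → M) {β γ : Y} (h : β < γ)
    (l : List (Y × M)) (hq : ∀ p ∈ l.head?, p.1 < γ → q p.1 = r p.1) :
    stepStack r β (stepStack q γ l) = stepStack q β l := by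
  cases l with
  | nil => simp [stepStack, pushStack, h, h.not_ge]
  | cons p t =>
    by_cases hp : p.1 ≤ γ
    · rw [stepStack, if_pos hp, stepStack, stepStack]
      by_cases hb : p.1 ≤ β
      · rw [if_pos hb, if_pos hb]
      · rw [if_neg hb, if_neg hb]
        rcases hp.lt_or_eq with h' | h'
        · rw [hq p (by simp) h']
        -- A top of index exactly `γ` is itself popped by `β`, so the data `q` and `r` are discarded
        -- and need not agree there.
        · rw [pushStack, pushStack, if_pos (h' ▸ h), if_pos (h' ▸ h)]
    · have hb : ¬ p.1 ≤ β := fun hb => hp (hb.trans h.le)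
      have e1 : stepStack q γ (p :: t) = pushStack γ (q p.1) (p :: t) := by
        rw [stepStack, if_neg hp]
      have e2 : stepStack q β (p :: t) = pushStack β (q p.1) (p :: t) := by
        rw [stepStack, if_neg hb]
      obtain ⟨s, t', e⟩ := exists_pushStack_eq_cons γ (q p.1) (p :: t)
      rw [e2, ← pushStack_pushStack h (q p.1) (r γ), e1, e, stepStack, if_neg h.not_ge]

end Stack

/-- States of the action of the generators: a stack and a value, which ends in the component
given by the top of the stack. -/
@[ext]
structure StackState {B Y S : Type u} [Semigroup S] (idx : B → Y) (g : B → S) where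
  stack : List (Y × WithOne S)
  val : WithOne S
  ends : ∀ p ∈ stack.head?, ∃ z d, idx d = p.1 ∧ val = z * (g d : WithOne S)

/-- `IsReducedProduct g idx e w c`: the element `w` is a product of generators, the first `e` and
the last `c`, in which consecutive indices are equal or incomparable. -/
inductive IsReducedProduct {B Y S : Type u} [Semigroup S] [Preorder Y] (g : B → S)
    (idx : B → Y) (e : B) : S → B → Prop
  | base : IsReducedProduct g idx e (g e) e
  | snoc {w : S} {c : B} (b : B) (h : IsReducedProduct g idx e w c)
      (hbc : idx b = idx c ∨ ¬ idx b ≤ idx c ∧ ¬ idx c ≤ idx b) :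
      IsReducedProduct g idx e (w * g b) b

theorem IsReducedProduct.exists_eq_mul {B Y S : Type u} [Semigroup S] [Preorder Y] {g : B → S}
    {idx : B → Y} {e c : B} {w : S} (h : IsReducedProduct g idx e w c) :
    ∃ z : WithOne S, (w : WithOne S) = z * g c := by
  cases h with
  | base => exact ⟨1, (one_mul _).symm⟩
  | snoc b h => exact ⟨_, WithOne.coe_mul _ _⟩

/-! ### The action on states and right cancellation. -/

section Action

variable {B Y S : Type u} [Semigroup B] [SemilatticeInf Y] [Semigroup S] {idx : B → Y} {g : B → S}

/-- The action of a generator on states. -/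
noncomputable def StackState.act (G : IsAdmissibleGrading idx) (hg : IsBasicPresentation g)
    (a : Y → B) (b : B) (σ : StackState idx g) : StackState idx g where
  stack := stepStack (fun α => σ.val * (g (a α) : WithOne S)) (idx b) σ.stack
  val := σ.val * (g b : WithOne S)
  ends := by
    intro p hp
    rcases hl : σ.stack with _ | ⟨p', t⟩
    · rw [hl] at hp
      simp only [stepStack, List.head?_cons, Option.mem_some_iff] at hp
      exact ⟨σ.val, b, by rw [← hp], rfl⟩
    · rw [hl, stepStack] at hp
      split_ifs at hp with h
      · simp only [List.head?_cons, Option.mem_some_iff] at hp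
        subst hp
        obtain ⟨z, d, hd, hz⟩ := σ.ends p' (by simp [hl])
        rw [← hd] at h
        refine ⟨z * (g d : WithOne S), b * d * b, (G.idx_conj h).trans hd, ?_⟩
        rw [hz, mul_assoc, mul_assoc, ← WithOne.coe_mul, ← WithOne.coe_mul,
          hg.mul_eq_mul_conj G h]
      · obtain ⟨r, t', e⟩ := exists_pushStack_eq_cons (idx b)
          (σ.val * (g (a p'.1) : WithOne S)) (p' :: t)
        rw [e] at hp
        simp only [List.head?_cons, Option.mem_some_iff] at hp
        exact ⟨σ.val, b, by rw [← hp], rfl⟩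

theorem IsBasicPair.idx_le_or_le (G : IsAdmissibleGrading idx) {e f : B} (h : IsBasicPair e f) :
    idx e ≤ idx f ∨ idx f ≤ idx e := by
  obtain ⟨x, hx, hy⟩ := h
  simp only [Set.mem_insert_iff, Set.mem_singleton_iff] at hx hy
  have : idx x = idx e ⊓ idx f := by
    rcases hy with rfl | rfl
    · exact G.idx_mul _ _
    · rw [G.idx_mul, inf_comm]
  rcases hx with rfl | rfl
  · exact Or.inl (inf_eq_left.1 this.symm)
  · exact Or.inr (inf_eq_right.1 this.symm)

/-- The indices of a basic pair are comparable. If `idx e ≤ idx f`, the letter `f` leaves the stack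
left by `e` alone. Otherwise `f` undoes what `e` pushed, and the stored data agree because `ha`
absorbs `g e`. -/
theorem StackState.act_act (G : IsAdmissibleGrading idx) (hg : IsBasicPresentation g) {a : Y → B}
    (ha : ∀ d x, idx d < idx x → g d * g x * g (a (idx d)) = g d * g (a (idx d)))
    {e f : B} (h : IsBasicPair e f) (σ : StackState idx g) :
    StackState.act G hg a f (StackState.act G hg a e σ) = StackState.act G hg a (e * f) σ := by
  ext1
  · simp only [StackState.act, G.idx_mul]
    by_cases hle : idx e ≤ idx f
    · rw [stepStack_stepStack_of_le _ _ hle, inf_eq_left.2 hle]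
    · have hlt : idx f < idx e := lt_of_le_not_ge ((h.idx_le_or_le G).resolve_left hle) hle
      rw [inf_eq_right.2 hlt.le]
      refine stepStack_stepStack_of_lt _ _ hlt _ fun p hp hpe => ?_
      obtain ⟨z, d, hd, hz⟩ := σ.ends p hp
      rw [← hd] at hpe ⊢
      rw [hz, mul_assoc, mul_assoc, mul_assoc, ← WithOne.coe_mul, ← WithOne.coe_mul,
        ← WithOne.coe_mul, ← mul_assoc (g d), ha _ _ hpe]
  · simp only [StackState.act]
    rw [mul_assoc, ← WithOne.coe_mul, hg.map_mul _ _ h]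

/-- Every element of `S¹` has a state, compatibly with multiplication by generators. -/
theorem exists_stackState (G : IsAdmissibleGrading idx) (hg : IsBasicPresentation g) {a : Y → B}
    (ha : ∀ d x, idx d < idx x → g d * g x * g (a (idx d)) = g d * g (a (idx d))) :
    ∃ D : WithOne S → StackState idx g, (∀ X, (D X).val = X) ∧
      ∀ X b, D (X * (g b : WithOne S)) = StackState.act G hg a b (D X) := by
  -- The opposite monoid turns composition into a right action: the left factor acts first.
  obtain ⟨F, hF⟩ := hg.exists_lift (Function.End (StackState idx g))ᵐᵒᵖ
    (fun b => MulOpposite.op (StackState.act G hg a b))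
    (fun x y h => unop_injective (funext fun σ => StackState.act_act G hg ha h σ))
  have hval : ∀ s, ∀ σ : StackState idx g,
      ((F s).unop σ).val = σ.val * (s : WithOne S) := by
    refine hg.induction _ (fun b σ => ?_) fun s t hs ht σ => ?_
    · rw [hF]; rfl
    · rw [map_mul]
      change ((F t).unop ((F s).unop σ)).val = _
      rw [ht, hs, WithOne.coe_mul, mul_assoc]
  refine ⟨fun X => (WithOne.lift F X).unop ⟨[], 1, by simp⟩, fun X => ?_, fun X b => ?_⟩
  · rcases X with _ | s
    · rfl
    · exact (hval s _).trans (one_mul _)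
  · simp only [map_mul, WithOne.lift_coe, hF]
    rfl

/-- After reading `c`, the value effectively ends in the image of `c` in the top component. It can
therefore be extended by that letter, which makes later multiplications inside that component
reversible. -/
theorem exists_act_stack_eq_cons (G : IsAdmissibleGrading idx) (hg : IsBasicPresentation g)
    (a : Y → B) (c : B) (σ : StackState idx g) :
    ∃ p t, (StackState.act G hg a c σ).stack = p :: t ∧ p.1 ≤ idx c ∧
      ∀ d, idx d = p.1 → σ.val * (g c : WithOne S) * (g (c * d * c) : WithOne S) =
        σ.val * (g c : WithOne S) := by
  have hc : ∀ d, idx d = idx c → σ.val * (g c : WithOne S) * (g (c * d * c) : WithOne S) =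
      σ.val * (g c : WithOne S) := fun d hd => by
    rw [G.conj_eq c hd, G.idem, G.idem, mul_assoc, ← WithOne.coe_mul, hg.map_idem G]
  rcases hl : σ.stack with _ | ⟨p, t⟩
  · exact ⟨(idx c, 1), [], by simp only [StackState.act, hl, stepStack], le_rfl, hc⟩
  · by_cases hp : p.1 ≤ idx c
    · refine ⟨p, t, by simp only [StackState.act, hl, stepStack, if_pos hp], hp, fun d hd => ?_⟩
      obtain ⟨z, e, he, hz⟩ := σ.ends p (by simp [hl])
      rw [← he] at hp
      rw [hz, G.conj_eq c (hd.trans he.symm), mul_assoc z, ← WithOne.coe_mul,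
        hg.mul_eq_mul_conj G hp, mul_assoc z, ← WithOne.coe_mul, mul_assoc, hg.map_idem G]
    · obtain ⟨r, t', e⟩ := exists_pushStack_eq_cons (idx c)
        (σ.val * (g (a p.1) : WithOne S)) (p :: t)
      exact ⟨(idx c, r), t', by simp only [StackState.act, hl, stepStack, if_neg hp, e], le_rfl, hc⟩

/-- The stack after `b` shows whether `b` was pushed. If not, `b` acts inside the top component,
hence reversibly; if so, the new entry stores `X * g c` up to a reversible factor. -/
theorem mul_right_cancel_of_incomparable (G : IsAdmissibleGrading idx)
    (hg : IsBasicPresentation g) {b c : B} (hbc : ¬ idx b ≤ idx c)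
    {X X' : WithOne S} (h : X * (g c : WithOne S) * (g b : WithOne S) = X' * g c * g b) :
    X * (g c : WithOne S) = X' * g c := by
  obtain ⟨a, ha, ha'⟩ := G.exists_section hg
  obtain ⟨D, hD, hDm⟩ := exists_stackState G hg ha'
  have key : ∀ X : WithOne S, ∃ p t, (D (X * (g c : WithOne S))).stack = p :: t ∧ p.1 ≤ idx c ∧
      ∀ d, idx d = p.1 → X * (g c : WithOne S) * (g (c * d * c) : WithOne S) =
        X * (g c : WithOne S) := fun X => by
    have := exists_act_stack_eq_cons G hg a c (D X)
    rwa [← hDm, hD] at this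
  have hlow : ∀ (X : WithOne S) (p : Y × WithOne S) t,
      (D (X * (g c : WithOne S))).stack = p :: t → p.1 ≤ idx b →
      (D (X * (g c : WithOne S) * (g b : WithOne S))).stack = p :: t := fun X p t hX hp => by
    rw [hDm (X * _), StackState.act]
    simp only [hX, stepStack, if_pos hp]
  have hinc : ∀ (X : WithOne S) (p : Y × WithOne S) t,
      (D (X * (g c : WithOne S))).stack = p :: t → p.1 ≤ idx c → ¬ p.1 ≤ idx b →
      (D (X * (g c : WithOne S) * (g b : WithOne S))).stack =
        (idx b, X * (g c : WithOne S) * (g (a p.1) : WithOne S)) :: p :: t :=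
    fun X p t hX hp hpb => by
      rw [hDm (X * _), StackState.act]
      have hlt : ¬ idx b < p.1 := fun h' => hbc (h'.le.trans hp)
      simp only [hX, stepStack, if_neg hpb, hD, pushStack, if_neg hlt]
  have hlow' : ∀ (X : WithOne S) (d : B), idx d ≤ idx c → idx d ≤ idx b →
      X * (g c : WithOne S) * (g (c * d * c) : WithOne S) = X * (g c : WithOne S) →
      X * (g c : WithOne S) * (g b : WithOne S) *
        (g (b * d * b * (c * d * c)) : WithOne S) = X * (g c : WithOne S) :=
    fun X d hdc hdb e => by
      have hi := G.idx_conj hdc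
      have hi' := G.idx_conj hdb
      have e' : g (c * d * c) * g b * g (b * d * b * (c * d * c)) = g (c * d * c) := by
        rw [hg.mul_eq_mul_conj G (hi.trans_le hdb), G.conj_eq b hi,
          hg.mul_mul_cancel G (hi.trans hi'.symm)]
      rw [← e]
      simp only [mul_assoc X, ← WithOne.coe_mul]
      simp only [mul_assoc] at e' ⊢
      rw [e']
  obtain ⟨p, t, hX, hp, hpe⟩ := key X
  obtain ⟨p', t', hX', hp', hpe'⟩ := key X'
  by_cases hb : p.1 ≤ idx b <;> by_cases hb' : p'.1 ≤ idx b
  · have hpp : p = p' := by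
      have e := hlow X p t hX hb
      rw [h, hlow X' p' t' hX' hb'] at e
      exact (List.cons.inj e).1.symm
    subst hpp
    have hd := ha p.1
    rw [← hlow' X (a p.1) (hd.trans_le hp) (hd.trans_le hb) (hpe _ hd), h,
      hlow' X' (a p.1) (hd.trans_le hp) (hd.trans_le hb) (hpe' _ hd)]
  -- Only one side pushed `b`. Comparing tops gives `idx b = p.1 ≤ idx c`, which is excluded.
  · have e := hlow X p t hX hb
    rw [h, hinc X' p' t' hX' hp' hb'] at e
    exact absurd ((congrArg Prod.fst (List.cons.inj e).1).trans_le hp) hbc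
  · have e := hlow X' p' t' hX' hb'
    rw [← h, hinc X p t hX hp hb] at e
    exact absurd ((congrArg Prod.fst (List.cons.inj e).1).trans_le hp') hbc
  -- Both sides pushed `b`: the tails give a common top, and the new entries give equal data, from
  -- which `hrec` recovers `X * g c` and `X' * g c` by one common factor.
  · have e := hinc X p t hX hp hb
    rw [h, hinc X' p' t' hX' hp' hb'] at e
    obtain ⟨e1, e2⟩ := List.cons.inj e
    obtain rfl := (List.cons.inj e2).1
    have e3 := congrArg Prod.snd e1
    have hd := ha p'.1
    have hi := G.idx_conj (hd.trans_le hp)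
    have hcan := hg.mul_mul_cancel G hi
    have hrec : ∀ X : WithOne S,
        X * (g c : WithOne S) * (g (c * a p'.1 * c) : WithOne S) = X * (g c : WithOne S) →
        X * (g c : WithOne S) * (g (a p'.1) : WithOne S) *
          (g (a p'.1 * (c * a p'.1 * c)) : WithOne S) = X * (g c : WithOne S) := fun X hX => by
      rw [← hX]
      simp only [mul_assoc X, ← WithOne.coe_mul]
      simp only [mul_assoc] at hcan ⊢
      rw [hcan]
    rw [← hrec X (hpe _ hd), ← hrec X' (hpe' _ hd)]
    simp only at e3
    rw [e3]

/-! ### Reduced products and their 𝓡*-classes. -/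

namespace IsReducedProduct

theorem mul_of_le (G : IsAdmissibleGrading idx) (hg : IsBasicPresentation g) {e c b : B} {w : S}
    (h : IsReducedProduct g idx e w c) (hcb : idx c ≤ idx b) :
    IsReducedProduct g idx e (w * g b) (b * c * b) := by
  obtain ⟨z, hz⟩ := h.exists_eq_mul
  have : w * g b = w * g (b * c * b) := WithOne.coe_injective (by
    rw [WithOne.coe_mul, hz, mul_assoc, ← WithOne.coe_mul, hg.mul_eq_mul_conj G hcb,
      WithOne.coe_mul, ← mul_assoc, ← hz, WithOne.coe_mul])
  rw [this]
  exact .snoc _ h (Or.inl (G.idx_conj hcb))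

/-- A lower letter `b` turns the last letter `c` into `c * b * c`, which is then multiplied into the
shorter product. The bound on the final index lets `b` itself be appended afterwards. The first
letter may change on the way. -/
theorem exists_mul (G : IsAdmissibleGrading idx) (hg : IsBasicPresentation g) {e c : B} {w : S}
    (h : IsReducedProduct g idx e w c) (b : B) :
    ∃ e' c', IsReducedProduct g idx e' (w * g b) c' ∧ idx c' ≤ idx b := by
  induction h generalizing b with
  | base =>
    by_cases h1 : idx e ≤ idx b
    · exact ⟨e, _, mul_of_le G hg .base h1, (G.idx_conj h1).trans_le h1⟩
    by_cases h2 : idx b ≤ idx e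
    · rw [hg.mul_eq_conj_mul G h2]
      exact ⟨_, b, .snoc _ .base (Or.inl (G.idx_conj h2).symm), le_rfl⟩
    · exact ⟨e, b, .snoc _ .base (Or.inr ⟨h2, h1⟩), le_rfl⟩
  | @snoc w c' c h hc ih =>
    have h' := IsReducedProduct.snoc c h hc
    by_cases h1 : idx c ≤ idx b
    · exact ⟨e, _, mul_of_le G hg h' h1, (G.idx_conj h1).trans_le h1⟩
    by_cases h2 : idx b ≤ idx c
    · rw [mul_assoc, hg.mul_eq_conj_mul G h2, ← mul_assoc]
      obtain ⟨e', d, hd, hle⟩ := ih (c * b * c)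
      rw [G.idx_conj h2] at hle
      exact ⟨e', _, mul_of_le G hg hd hle, (G.idx_conj hle).trans_le hle⟩
    · exact ⟨e, b, .snoc _ h' (Or.inr ⟨h2, h1⟩), le_rfl⟩

theorem exists_of_presentation (G : IsAdmissibleGrading idx) (hg : IsBasicPresentation g) (s : S) :
    ∃ e c, IsReducedProduct g idx e s c := by
  suffices h : (∃ e c, IsReducedProduct g idx e s c) ∧
      ∀ w e c, IsReducedProduct g idx e w c → ∃ e' c', IsReducedProduct g idx e' (w * s) c' from h.1
  refine hg.induction (fun s => (∃ e c, IsReducedProduct g idx e s c) ∧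
      ∀ w e c, IsReducedProduct g idx e w c → ∃ e' c', IsReducedProduct g idx e' (w * s) c')
    (fun b => ⟨⟨b, b, .base⟩, fun w e c h => ?_⟩) (fun s t hs ht => ?_) s
  · obtain ⟨e', c', h', -⟩ := h.exists_mul G hg b
    exact ⟨e', c', h'⟩
  · obtain ⟨⟨e, c, h⟩, hs⟩ := hs
    refine ⟨ht.2 _ _ _ h, fun w e c h => ?_⟩
    obtain ⟨e', c', h'⟩ := hs w e c h
    rw [← mul_assoc]
    exact ht.2 _ _ _ h'

theorem rStar (G : IsAdmissibleGrading idx) (hg : IsBasicPresentation g) {e c : B} {w : S}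
    (h : IsReducedProduct g idx e w c) : RStar w (g e) := by
  induction h with
  | base => exact fun _ _ => Iff.rfl
  | @snoc w c b h hbc ih =>
    refine fun x y => Iff.trans ⟨fun hxy => ?_, fun hxy => ?_⟩ (ih x y)
    · obtain ⟨z, hz⟩ := h.exists_eq_mul
      rw [WithOne.coe_mul, hz, ← mul_assoc, ← mul_assoc, ← mul_assoc, ← mul_assoc] at hxy
      rw [hz, ← mul_assoc, ← mul_assoc]
      rcases hbc with hbc | ⟨hbc, -⟩
      · have e := hg.mul_mul_cancel G hbc.symm
        rw [← e, WithOne.coe_mul, WithOne.coe_mul]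
        simp only [← mul_assoc]
        rw [hxy]
      · exact mul_right_cancel_of_incomparable G hg hbc hxy
    · rw [WithOne.coe_mul, ← mul_assoc, hxy, mul_assoc]

end IsReducedProduct

theorem exists_idempotent_rStar (G : IsAdmissibleGrading idx) (hg : IsBasicPresentation g) (s : S) :
    ∃ e : S, IsIdempotentElem e ∧ RStar s e := by
  obtain ⟨e, c, h⟩ := IsReducedProduct.exists_of_presentation G hg s
  exact ⟨g e, hg.map_idem G e, h.rStar G hg⟩

end Action

/-! ### Duality and abundance. -/

theorem RStar.lStar_of_op {S : Type*} [Semigroup S] {a b : S} (h : RStar (op a) (op b)) :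
    LStar a b := by
  let τ : WithOne S → WithOne Sᵐᵒᵖ := Option.map MulOpposite.op
  have hτ : Function.Injective τ := Option.map_injective op_injective
  have hmul : ∀ (a : S) (x : WithOne S), τ (a * x) = τ x * ((op a : Sᵐᵒᵖ) : WithOne Sᵐᵒᵖ) := by
    rintro a (_ | x) <;> rfl
  intro x y
  have := h (τ x) (τ y)
  rwa [← hmul, ← hmul, ← hmul, ← hmul, hτ.eq_iff, hτ.eq_iff] at this

/-- A semigroup presented by the basic pairs of an admissibly graded normal band is abundant. -/
theorem IsAdmissibleGrading.isAbundant {B Y S : Type u} [Semigroup B] [SemilatticeInf Y]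
    [Semigroup S] {idx : B → Y} {g : B → S} (G : IsAdmissibleGrading idx)
    (hg : IsBasicPresentation g) : IsAbundant S := by
  refine ⟨fun s => ?_, exists_idempotent_rStar G hg⟩
  obtain ⟨e, he, h⟩ := exists_idempotent_rStar G.op hg.op (MulOpposite.op s)
  exact ⟨unop e, op_injective he, RStar.lStar_of_op h⟩

/-! ### Application to `IG B` for Y-basic and pliant bands. -/

/-- The generator of `IG B` given by an element of the band `B`. -/
def IG.of {B : Type u} [Semigroup B] (hB : IsBand B) (b : B) : IG B :=
  ((FreeSemigroup.of ⟨b, hB b⟩ : FreeSemigroup (Idem B)) : (conGen (IGRel B)).Quotient)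

theorem IG.isBasicPresentation {B : Type u} [Semigroup B] (hB : IsBand B) :
    IsBasicPresentation (IG.of hB) where
  map_mul e f h := (Con.eq _).2 (ConGen.Rel.of _ _ (IGRel.basic ⟨e, hB e⟩ ⟨f, hB f⟩ h))
  induction P h1 h2 s := by
    induction s using Con.induction_on with
    | H w =>
      induction w using FreeSemigroup.recOnMul with
      | ih1 b => exact h1 b.1
      | ih2 x y hx hy => exact h2 _ _ hx hy
  exists_lift T _ f hf := by
    let F : FreeSemigroup (Idem B) →ₙ* T := FreeSemigroup.lift fun b => f b.1
    have hF : conGen (IGRel B) ≤ Con.ker F := by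
      refine Con.conGen_le.2 ?_
      rintro _ _ ⟨e, f', h⟩
      change F (_ * _) = F _
      simpa [F] using hf e f' h
    refine ⟨⟨fun q => Con.liftOn q F fun _ _ h => hF h, fun x y => ?_⟩, fun b => ?_⟩
    · induction x using Con.induction_on
      induction y using Con.induction_on
      exact map_mul F _ _
    · rfl

theorem SemilatticeOfRectangularBands.mul_mul_cancel {B Y : Type*} [Semigroup B]
    [SemilatticeInf Y] (G : SemilatticeOfRectangularBands B Y) {x y : B}
    (h : G.index x = G.index y) : x * y * x = x :=
  congrArg Subtype.val ((G.rectangular (G.index x)).2 ⟨x, rfl⟩ ⟨y, h.symm⟩)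

theorem IsYBasic.exists_isAdmissibleGrading {B : Type u} [Semigroup B] (hB : IsNormalBand B)
    (h : IsYBasic B) :
    ∃ (Y : Type u) (_ : SemilatticeInf Y) (idx : B → Y), IsAdmissibleGrading idx := by
  obtain ⟨Y, _, G, hG⟩ := h
  refine ⟨Y, _, G.index, G.index_mul, hB.1, fun x y => G.mul_mul_cancel, hB.2, fun α => ?_⟩
  obtain ⟨a, ha⟩ := G.index_surjective α
  refine ⟨a, ha, ?_⟩
  rcases hG α with h | h
  · exact Or.inl fun x y hx hy => congrArg Subtype.val (h ⟨x, hx⟩ ⟨y, hy⟩)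
  · exact Or.inr (Or.inl fun x y hx hy => congrArg Subtype.val (h ⟨x, hx⟩ ⟨y, hy⟩))

/-- Both products are computed in the lower component, where `x` acts as its image, and the
rectangular law there removes `d`. This translates pliancy into a condition on conjugates. -/
theorem StrongSemilatticeOfRectangularBands.mul_mul_eq {B Y : Type*} [Semigroup B]
    [SemilatticeInf Y] (G : StrongSemilatticeOfRectangularBands B Y) {α β : Y} (h : α ≤ β)
    (x : G.component β) (d : G.component α) : (x * d * x : B) = G.φ h x := by
  -- The index is generalised to `γ` because the component types at `β ⊓ α` and `α` agree only
  -- propositionally; substituting `γ` avoids transport.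
  have key : ∀ γ (hβ : γ ≤ β) (hα : γ ≤ α) (e : γ = β ⊓ α) (_ : γ = α),
      ((G.φ hβ x * G.φ hα d : G.component γ) : B) = (G.φ h x : B) * d := by
    rintro γ hβ hα - rfl
    rw [G.φ_refl]; rfl
  have key' : ∀ (y : G.component α) γ (hβ : γ ≤ β) (hα : γ ≤ α) (_ : γ = α),
      ((G.φ hα y * G.φ hβ x : G.component γ) : B) = (y : B) * (G.φ h x : B) := by
    rintro y γ hβ hα rfl
    rw [G.φ_refl]; rfl
  rw [G.mul_eq x d, key _ _ _ rfl (inf_eq_right.2 h)]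
  have := (G.mul_eq (G.φ h x * d) x).trans (key' _ _ _ _ (inf_eq_left.2 h))
  exact this.trans (congrArg Subtype.val ((G.rectangular α).2 (G.φ h x) d))

theorem IsPliant.exists_isAdmissibleGrading {B : Type u} [Semigroup B] (hB : IsNormalBand B)
    (h : IsPliant B) :
    ∃ (Y : Type u) (_ : SemilatticeInf Y) (idx : B → Y), IsAdmissibleGrading idx := by
  obtain ⟨Y, _, G, hG⟩ := h
  refine ⟨Y, _, G.index, G.index_mul, hB.1, fun x y => G.mul_mul_cancel, hB.2, fun α => ?_⟩
  obtain ⟨a, ha⟩ := hG α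
  refine ⟨a, a.2, Or.inr (Or.inr fun x d hx hd => ?_)⟩
  rw [← ha _ hx ⟨x, rfl⟩]
  exact G.mul_mul_eq hx.le ⟨x, rfl⟩ ⟨d, hd⟩

end IGBand

theorem mainTheorem3 (B : Type u) [Semigroup B] (hB : IGBand.IsNormalBand B)
    (h : IGBand.IsYBasic B ∨ IGBand.IsPliant B) : IGBand.IsAbundant (IGBand.IG B) := by
  obtain ⟨Y, _, idx, G⟩ := h.elim (IGBand.IsYBasic.exists_isAdmissibleGrading hB)
    (IGBand.IsPliant.exists_isAdmissibleGrading hB)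
  exact G.isAbundant (IGBand.IG.isBasicPresentation hB.1)
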